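/- **Setting.** A *two-player win-lose coordination game* $G$ consists of finite non-empty disjoint choice sets $C_1,C_2$ and a winning relation $W\subseteq C_1\times C_2$ such that every choice belongs to some winning profile. In repeated play, in each round both players simultaneously pick a choice, seeing the full history of previously picked profiles; the play stops as soon as a winning profile is picked. A *stage* $(G,\mathcal H)$ is a game with a finite sequence $\mathcal H$ of choice profiles (its history); it is *final* if a winning profile occurs in $\mathcal H$. A *renaming* between two stages is a permutation of the players together with a bijection between the domains that respects the choice sets (up to the permutation of players) and preserves the winning relation and each round of the history. A *protocol* assigns to every stage of every two-player game and every player role $i$ a probability distribution on $C_i$; all protocols are required to be *structural*, i.e. invariant under renamings of stages. The *expected coordination time* (ECT) of a protocol in $G$ is the expected number of rounds until coordination (possibly $\infty$) when both players follow the protocol, randomizing independently, from the stage with empty history. A protocol is *ECT-optimal* for $G$ if no protocol has a smaller ECT in $G$. A non-final stage is *reachable* with a protocol if it occurs with positive probability when both players follow it. A protocol $\pi$ is *uniquely ECT-optimal* for $G$ if it is ECT-optimal and every ECT-optimal protocol for $G$ agrees with $\pi$ at all stages of $G$ reachable with $\pi$. The game $\mathrm{CM}_4$ is the two-player game in which each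 player has four choices and the winning profiles are four pairwise disjoint pairs. The *wait-or-move protocol* WM is the following: the first choice is uniformly random; at a later non-final stage, if each player has picked only one choice so far (possibly several times), play with probability $\tfrac12$ one's own earlier choice, and with total probability $\tfrac12$, uniformly, one of the choices that coordinate with the other player's earlier choice; if each player has picked exactly two choices so far, play each of one's own two earlier choices with probability $\tfrac12$; at all other stages choose uniformly at random. **Theorem.** WM is ECT-optimal for $\mathrm{CM}_4$, and the optimal ECT is $2+\tfrac12$. There are, however, continuum many other ECT-optimal protocols for $\mathrm{CM}_4$: the set of restrictions to the stages of $\mathrm{CM}_4$ of ECT-optimal protocols, without the restriction of WM, has cardinality exactly $2^{\aleph_0}$, and the same is true if each protocol is restricted to only those (non-final) stages of $\mathrm{CM}_4$ that are reachable with it. Consequently no protocol is uniquely ECT-optimal for $\mathrm{CM}_4$. -/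

import Mathlib

open scoped ENNReal Cardinal

noncomputable section

/-- An `n`-player win-lose coordination game. The disjoint choice sets of the players are the
types `Choice i` (the domain of the game is their disjoint union), `Win` is the winning
relation, and there are no surely losing choices. -/
structure WLCGame (n : ℕ) where
  Choice : Fin n → Type
  fintypeChoice : ∀ i, Fintype (Choice i)
  nonemptyChoice : ∀ i, Nonempty (Choice i)
  Win : Set (∀ i, Choice i)
  no_losing : ∀ (i : Fin n) (c : Choice i), ∃ σ ∈ Win, σ i = c

attribute [instance] WLCGame.fintypeChoice WLCGame.nonemptyChoice

namespace WLCGame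

variable {n : ℕ}

/-- Choice profiles. -/
abbrev Profile (G : WLCGame n) : Type := ∀ i, G.Choice i

end WLCGame

/-- The choice matching game with `n` players and `m` choices for each player: the `m` winning
profiles are the pairwise disjoint constant ones. -/
def choiceMatching (n m : ℕ) [NeZero m] : WLCGame n where
  Choice _ := Fin m
  fintypeChoice _ := inferInstance
  nonemptyChoice _ := inferInstance
  Win := {σ | ∀ i j, σ i = σ j}
  no_losing _ c := ⟨fun _ => c, fun _ _ => rfl, rfl⟩

/-- The two-player choice matching game with `m` choices. -/
abbrev CM (m : ℕ) [NeZero m] : WLCGame 2 := choiceMatching 2 m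

/-- A stage of a repeated play: a game with the sequence of the choice profiles played so far
(in the order in which they were played). -/
structure Stage (n : ℕ) where
  game : WLCGame n
  history : List game.Profile

namespace Stage

variable {n : ℕ}

/-- The initial stage of a game. -/
def initial (G : WLCGame n) : Stage n := ⟨G, []⟩

/-- The stage that results when the profile `σ` is played at `S`. -/
def extend (S : Stage n) (σ : S.game.Profile) : Stage n := ⟨S.game, S.history ++ [σ]⟩

/-- Coordination has already happened. -/
def IsFinal (S : Stage n) : Prop := ∃ σ ∈ S.history, σ ∈ S.game.Win

open Classical in
/-- The set of the choices that player `i` has selected in the previous rounds. -/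
def played (S : Stage n) (i : Fin n) : Finset (S.game.Choice i) :=
  (S.history.map fun σ => σ i).toFinset

end Stage

/-- A renaming between two stages: a permutation `perm` of the players together with a bijection
between the domains mapping the choices of player `perm i` onto those of player `i`, which
preserves the winning relation (in both directions) and every round of the history. -/
structure Renaming {n : ℕ} (S S' : Stage n) where
  perm : Equiv.Perm (Fin n)
  toEquiv : ∀ i, S.game.Choice (perm i) ≃ S'.game.Choice i
  win_iff : ∀ σ : S.game.Profile,
    σ ∈ S.game.Win ↔ (fun i => toEquiv i (σ (perm i))) ∈ S'.game.Win
  history_eq : S'.history = S.history.map fun σ i => toEquiv i (σ (perm i))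

/-- A (not necessarily structural) protocol: a mixed strategy for every player role at every
stage of every `n`-player game. -/
abbrev Protocol (n : ℕ) : Type 1 := (S : Stage n) → (i : Fin n) → PMF (S.game.Choice i)

namespace Protocol

variable {n : ℕ}

/-- A protocol is structural if it is indifferent with respect to renamings. -/
def IsStructural (π : Protocol n) : Prop :=
  ∀ (S S' : Stage n) (r : Renaming S S') (i : Fin n) (c : S.game.Choice (r.perm i)),
    π S (r.perm i) c = π S' i (r.toEquiv i c)

/-- The probability that the profile `σ` is played at `S` when all players follow `π`
(independently of each other). -/
def profileProb (π : Protocol n) (S : Stage n) (σ : S.game.Profile) : ℝ≥0∞ :=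
  ∏ i, π S i (σ i)

open Classical in
/-- The probability that, starting from `S` with all players following `π`, coordination is
reached after exactly `k` further rounds. -/
def coordProb (π : Protocol n) : ℕ → Stage n → ℝ≥0∞
  | 0, S => if S.IsFinal then 1 else 0
  | k + 1, S =>
      if S.IsFinal then 0
      else ∑ σ : S.game.Profile, π.profileProb S σ * coordProb π k (S.extend σ)

/-- The expected coordination time from `S` with `π`: the expected value of the number of rounds
until coordination. The second summand accounts for the plays that never coordinate, for which
this number is infinite (with the convention `∞ * 0 = 0`). -/
def ect (π : Protocol n) (S : Stage n) : ℝ≥0∞ :=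
  ∑' k : ℕ, (k : ℝ≥0∞) * π.coordProb k S + ⊤ * (1 - ∑' k : ℕ, π.coordProb k S)

/-- `π` is a structural protocol with the minimum expected coordination time in `G` among all
structural protocols. -/
def IsECTOptimal (π : Protocol n) (G : WLCGame n) : Prop :=
  π.IsStructural ∧
    ∀ π' : Protocol n, π'.IsStructural → π.ect (Stage.initial G) ≤ π'.ect (Stage.initial G)

/-- `π.Reachable G H`: the non-final stage `(G, H)` is reached with positive probability from
the initial stage of `G` when all players follow `π`. (Final stages are left out: there the play
has ended, and no further choices are made.) -/
inductive Reachable (π : Protocol n) (G : WLCGame n) : List G.Profile → Prop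
  | initial : Reachable π G []
  | step (H : List G.Profile) (σ : G.Profile) :
      Reachable π G H → σ ∉ G.Win → π.profileProb ⟨G, H⟩ σ ≠ 0 → Reachable π G (H ++ [σ])

/-- Unique optimality: every optimal protocol acts as `π` does at all stages that are reachable
with `π`. -/
def IsUniquelyECTOptimal (π : Protocol n) (G : WLCGame n) : Prop :=
  π.IsECTOptimal G ∧
    ∀ π' : Protocol n, π'.IsECTOptimal G →
      ∀ H : List G.Profile, π.Reachable G H → π' ⟨G, H⟩ = π ⟨G, H⟩

/-- The restriction of `π` to the stages of `G`. -/
def restrict (π : Protocol n) (G : WLCGame n) :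
    List G.Profile → ∀ i, PMF (G.Choice i) :=
  fun H => π ⟨G, H⟩

open Classical in
/-- The restriction of `π` to those stages of `G` that are reachable with `π` (as a partial
function on the histories). -/
def reachableRestrict (π : Protocol n) (G : WLCGame n) :
    List G.Profile → Option (∀ i, PMF (G.Choice i)) :=
  fun H => if π.Reachable G H then some (π ⟨G, H⟩) else none

end Protocol

open Classical in
/-- In a two-player game, the choices of player `i` that coordinate with the choice `c` of the
other player `i.rev`. -/
def coordinating (G : WLCGame 2) (i : Fin 2) (c : G.Choice i.rev) : Finset (G.Choice i) :=
  Finset.univ.filter fun d => ∃ σ ∈ G.Win, σ i = d ∧ σ i.rev = c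

theorem coordinating_nonempty (G : WLCGame 2) (i : Fin 2) (c : G.Choice i.rev) :
    (coordinating G i c).Nonempty := by
  obtain ⟨σ, hσ, h⟩ := G.no_losing i.rev c
  exact ⟨σ i, by simpa [coordinating] using ⟨σ, hσ, rfl, h⟩⟩

theorem played_cons_nonempty {n : ℕ} (G : WLCGame n) (σ : G.Profile) (H : List G.Profile)
    (i : Fin n) : ((Stage.mk G (σ :: H)).played i).Nonempty :=
  ⟨σ i, by simp [Stage.played]⟩

open Classical in
/-- The wait-or-move protocol. The first choice is uniformly random. At a non-final stage,
* if each player has selected only a single choice so far, play one's own earlier choice with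
  probability `1/2` and, with probability `1/2`, a uniformly random choice among those that
  coordinate with the earlier choice of the other player;
* if each player has selected exactly two choices so far, play each of one's own two earlier
  choices with probability `1/2`.
At all other stages, the choice is uniformly random. -/
def waitOrMove : Protocol 2
  | ⟨_, []⟩, _ => PMF.uniformOfFintype _
  | ⟨G, σ :: H⟩, i =>
      let S : Stage 2 := ⟨G, σ :: H⟩
      if S.IsFinal then PMF.uniformOfFintype _
      else if ∀ j, (S.played j).card = 1 then
        (PMF.uniformOfFintype Bool).bind fun b =>
          if b then PMF.pure (σ i)
          else PMF.uniformOfFinset (coordinating G i (σ i.rev)) (coordinating_nonempty G i _)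
      else if ∀ j, (S.played j).card = 2 then
        PMF.uniformOfFinset (S.played i) (played_cons_nonempty G σ H i)
      else PMF.uniformOfFintype _

end

/-!
After a missed first round `(x, y)` of `CM 4` some fixed-point-free involution `f` exchanges `x` and
`y`. As long as all rounds are of the form `(z, f z)`, exchanging the players and applying `f` is a
renaming of the stage to itself, so a structural protocol lets the second player play the first
player's strategy `p` composed with `f`. By the rearrangement inequality the round is then won with
probability `∑ z, p z * p (f z) ≤ ∑ z, p z * p z`, which is the probability that the next stage is
again of this form. Hence at least `2` further rounds are needed on average. The first round is
forced to be uniform and wins with probability `1 / 4`, so `1 + 3 / 4 * 2 = 2 + 1 / 2` is optimal.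

The bound is attained by any structural protocol with which, after a missed first round, both
players choose uniformly from a common pair of choices. Wait-or-move always uses the two touched
choices. One may just as well decide in every round between these and the two remaining choices;
all sequences of such decisions lead to different optimal protocols, already at reachable stages.
-/

theorem tsum_mul_add_top_mul_eq_tsum {c s : ℕ → ℝ≥0∞} {t : ℝ≥0∞} (ht : t ≠ ⊤)
    (h : ∀ k, ∑ j ∈ Finset.range (k + 1), c j + s k = t) :
    ∑' k : ℕ, (k : ℝ≥0∞) * c k + ⊤ * (t - ∑' k, c k) = ∑' k, s k := by
  have hc : ∑' k, c k ≤ t := ENNReal.tsum_le_of_sum_range_le fun k =>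
    (Finset.sum_le_sum_of_subset (Finset.range_mono k.le_succ)).trans (le_self_add.trans (h k).le)
  have htail (k : ℕ) : s k = ∑' j, (if k < j then c j else 0) + (t - ∑' j, c j) := by
    have hsplit : ∑ j ∈ Finset.range (k + 1), c j + ∑' j, (if k < j then c j else 0) =
        ∑' j, c j := by
      rw [← ENNReal.sum_add_tsum_compl (Finset.range (k + 1)) c, tsum_subtype]
      simp [Set.indicator_apply]
    have hne : ∑ j ∈ Finset.range (k + 1), c j ≠ ⊤ :=
      ne_top_of_le_ne_top ht (le_self_add.trans (h k).le)
    rw [← ENNReal.add_right_inj hne, h, ← add_assoc, hsplit, add_tsub_cancel_of_le hc]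
  have hcount (j : ℕ) : ∑' k, (if k < j then c j else 0) = j * c j := by
    rw [tsum_eq_sum (s := Finset.range j) fun k hk => if_neg (by simpa using hk),
      Finset.sum_congr rfl fun k hk => if_pos (Finset.mem_range.1 hk)]
    simp
  simp only [htail, ENNReal.tsum_add, ENNReal.tsum_const, ENat.card_eq_top_of_infinite,
    ENat.toENNReal_top]
  rw [ENNReal.tsum_comm]
  simp only [hcount]

namespace Stage

variable {n : ℕ} {S : Stage n}

theorem mem_played {i : Fin n} {c : S.game.Choice i} :
    c ∈ S.played i ↔ ∃ σ ∈ S.history, σ i = c := by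
  simp [played]

theorem not_isFinal_initial (G : WLCGame n) : ¬ (initial G).IsFinal := by
  rintro ⟨σ, hσ, -⟩
  exact List.not_mem_nil hσ

theorem isFinal_extend {σ : S.game.Profile} :
    (S.extend σ).IsFinal ↔ S.IsFinal ∨ σ ∈ S.game.Win := by
  change (∃ τ ∈ S.history ++ [σ], τ ∈ S.game.Win) ↔ _
  simp only [IsFinal, List.mem_append, List.mem_singleton, or_and_right, exists_or,
    exists_eq_left]

end Stage

namespace Protocol

variable {n : ℕ} (π : Protocol n) {S : Stage n}

theorem sum_profileProb (S : Stage n) : ∑ σ : S.game.Profile, π.profileProb S σ = 1 := by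
  classical
  have hsum (i : Fin n) : ∑ c, π S i c = 1 := (tsum_fintype _).symm.trans (π S i).tsum_coe
  calc ∑ σ : S.game.Profile, π.profileProb S σ
      = ∏ i, ∑ c, π S i c := (Fintype.prod_sum fun i c => π S i c).symm
    _ = 1 := Finset.prod_eq_one fun i _ => hsum i

/-- The expected value of `ψ` at the profile played at `S` when all players follow `π`. -/
noncomputable def expectation (S : Stage n) (ψ : S.game.Profile → ℝ≥0∞) : ℝ≥0∞ :=
  ∑ σ, π.profileProb S σ * ψ σ

/-- The probability that the profile played at `S` belongs to `E` when all players follow `π`. -/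
noncomputable def eventProb (S : Stage n) (E : Set S.game.Profile) : ℝ≥0∞ :=
  π.expectation S (E.indicator 1)

section Expectation

variable {ψ ψ' : S.game.Profile → ℝ≥0∞} {c : ℝ≥0∞} {E : Set S.game.Profile}

theorem expectation_mono (h : ∀ σ, π.profileProb S σ ≠ 0 → ψ σ ≤ ψ' σ) :
    π.expectation S ψ ≤ π.expectation S ψ' := by
  refine Finset.sum_le_sum fun σ _ => ?_
  by_cases hσ : π.profileProb S σ = 0
  · simp [hσ]
  · exact mul_le_mul_right (h σ hσ) _

theorem expectation_const : π.expectation S (fun _ => c) = c := by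
  rw [expectation, ← Finset.sum_mul, sum_profileProb, one_mul]

theorem expectation_add :
    π.expectation S (fun σ => ψ σ + ψ' σ) = π.expectation S ψ + π.expectation S ψ' := by
  simp only [expectation, mul_add, Finset.sum_add_distrib]

theorem expectation_mul_indicator :
    π.expectation S (fun σ => c * E.indicator 1 σ) = c * π.eventProb S E := by
  simp only [eventProb, expectation, Finset.mul_sum, mul_left_comm]

theorem expectation_finsetSum {ι : Type*} (s : Finset ι) (ψ : ι → S.game.Profile → ℝ≥0∞) :
    π.expectation S (fun σ => ∑ k ∈ s, ψ k σ) = ∑ k ∈ s, π.expectation S (ψ k) := by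
  simp only [expectation, Finset.mul_sum]
  exact Finset.sum_comm

theorem expectation_tsum {ι : Type*} (ψ : ι → S.game.Profile → ℝ≥0∞) :
    π.expectation S (fun σ => ∑' k, ψ k σ) = ∑' k, π.expectation S (ψ k) := by
  simp only [expectation, ← ENNReal.tsum_mul_left]
  exact (Summable.tsum_finsetSum fun _ _ => ENNReal.summable).symm

theorem eventProb_le_one : π.eventProb S E ≤ 1 :=
  (π.expectation_mono fun σ _ => Set.indicator_le_self' (fun _ _ => zero_le_one) σ).trans_eq
    π.expectation_const

theorem le_expectation_add_mul_eventProb (h : ∀ σ ∉ E, c ≤ ψ σ) :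
    c ≤ π.expectation S ψ + c * π.eventProb S E := by
  rw [← expectation_mul_indicator, ← expectation_add]
  refine π.expectation_const.ge.trans (π.expectation_mono fun σ _ => ?_)
  by_cases hσ : σ ∈ E
  · simp [hσ]
  · simpa [hσ] using h σ hσ

theorem expectation_add_mul_eventProb_le (hE : ∀ σ ∈ E, ψ σ = 0)
    (h : ∀ σ ∉ E, π.profileProb S σ ≠ 0 → ψ σ ≤ c) :
    π.expectation S ψ + c * π.eventProb S E ≤ c := by
  rw [← expectation_mul_indicator, ← expectation_add]
  refine (π.expectation_mono fun σ hp => ?_).trans_eq π.expectation_const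
  by_cases hσ : σ ∈ E
  · simp [hσ, hE σ hσ]
  · simpa [hσ] using h σ hσ hp

end Expectation

open Classical in
/-- The probability that, starting from `S` with all players following `π`, coordination is not
reached within `k` further rounds; the complement of the partial sums of `coordProb`. -/
noncomputable def survivalProb (π : Protocol n) : ℕ → Stage n → ℝ≥0∞
  | 0, S => if S.IsFinal then 0 else 1
  | k + 1, S =>
      if S.IsFinal then 0 else π.expectation S fun σ => survivalProb π k (S.extend σ)

theorem survivalProb_of_isFinal (h : S.IsFinal) (k : ℕ) : π.survivalProb k S = 0 := by
  cases k <;> simp [survivalProb, h]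

theorem survivalProb_zero (h : ¬ S.IsFinal) : π.survivalProb 0 S = 1 := by
  simp [survivalProb, h]

theorem survivalProb_succ (h : ¬ S.IsFinal) (k : ℕ) :
    π.survivalProb (k + 1) S = π.expectation S fun σ => π.survivalProb k (S.extend σ) := by
  simp [survivalProb, h]

theorem coordProb_succ (h : ¬ S.IsFinal) (k : ℕ) :
    π.coordProb (k + 1) S = π.expectation S fun σ => π.coordProb k (S.extend σ) := by
  simp [coordProb, expectation, h]

theorem sum_coordProb_add_survivalProb (k : ℕ) (S : Stage n) :
    ∑ j ∈ Finset.range (k + 1), π.coordProb j S + π.survivalProb k S = 1 := by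
  induction k generalizing S with
  | zero => by_cases h : S.IsFinal <;> simp [coordProb, survivalProb, h]
  | succ k ih =>
    rw [Finset.sum_range_succ']
    by_cases h : S.IsFinal
    · simp [coordProb, survivalProb, h]
    · simp only [coordProb_succ π h, survivalProb_succ π h]
      rw [coordProb, if_neg h, add_zero, ← expectation_finsetSum, ← expectation_add]
      simp only [ih, expectation_const]

theorem ect_eq_tsum_survivalProb (S : Stage n) : π.ect S = ∑' k, π.survivalProb k S :=
  tsum_mul_add_top_mul_eq_tsum ENNReal.one_ne_top fun k => π.sum_coordProb_add_survivalProb k S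

theorem ect_of_isFinal (h : S.IsFinal) : π.ect S = 0 := by
  simp [ect_eq_tsum_survivalProb, survivalProb_of_isFinal π h]

theorem ect_of_not_isFinal (h : ¬ S.IsFinal) :
    π.ect S = 1 + π.expectation S fun σ => π.ect (S.extend σ) := by
  simp only [ect_eq_tsum_survivalProb, expectation_tsum]
  rw [tsum_eq_zero_add' ENNReal.summable, survivalProb_zero π h]
  simp only [survivalProb_succ π h]

theorem one_le_ect (h : ¬ S.IsFinal) : 1 ≤ π.ect S :=
  le_self_add.trans_eq (π.ect_of_not_isFinal h).symm

section FixedGame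

variable {G : WLCGame n}

theorem ect_le_of_step_le {φ : List G.Profile → ℝ≥0∞}
    (hφ : ∀ H, ¬ (Stage.mk G H).IsFinal →
      1 + π.expectation ⟨G, H⟩ (fun σ => φ (H ++ [σ])) ≤ φ H) (H : List G.Profile) :
    π.ect ⟨G, H⟩ ≤ φ H := by
  rw [ect_eq_tsum_survivalProb]
  refine ENNReal.tsum_le_of_sum_range_le fun N => ?_
  induction N generalizing H with
  | zero => simp
  | succ N ih =>
    by_cases h : (Stage.mk G H).IsFinal
    · simp [survivalProb_of_isFinal π h]
    · rw [Finset.sum_range_succ', add_comm, survivalProb_zero π h]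
      simp only [survivalProb_succ π h, ← expectation_finsetSum]
      exact (add_le_add_right (π.expectation_mono fun σ _ => ih _) 1).trans (hφ H h)

theorem ect_le_inv_of_le_eventProb_win {K : Set (List G.Profile)} {q : ℝ≥0∞}
    (hfinal : ∀ H ∈ K, ¬ (Stage.mk G H).IsFinal)
    (hwin : ∀ H ∈ K, q ≤ π.eventProb ⟨G, H⟩ G.Win)
    (hnext : ∀ H ∈ K, ∀ σ ∉ G.Win, π.profileProb ⟨G, H⟩ σ ≠ 0 → H ++ [σ] ∈ K)
    {H : List G.Profile} (hH : H ∈ K) : π.ect ⟨G, H⟩ ≤ q⁻¹ := by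
  classical
  let φ (H : List G.Profile) : ℝ≥0∞ :=
    if (Stage.mk G H).IsFinal then 0 else if H ∈ K then q⁻¹ else ⊤
  have hφK {H} (hH : H ∈ K) : φ H = q⁻¹ := (if_neg (hfinal H hH)).trans (if_pos hH)
  rw [← hφK hH]
  refine π.ect_le_of_step_le (fun H hH => ?_) H
  by_cases hK : H ∈ K
  · rw [hφK hK]
    rcases eq_or_ne q 0 with rfl | hq
    · simp
    have hq' : q ≠ ⊤ :=
      ne_top_of_le_ne_top ENNReal.one_ne_top ((hwin H hK).trans π.eventProb_le_one)
    calc 1 + π.expectation ⟨G, H⟩ (fun σ => φ (H ++ [σ]))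
        = q⁻¹ * q + π.expectation ⟨G, H⟩ (fun σ => φ (H ++ [σ])) := by
          rw [ENNReal.inv_mul_cancel hq hq']
      _ ≤ q⁻¹ * π.eventProb ⟨G, H⟩ G.Win + π.expectation ⟨G, H⟩ (fun σ => φ (H ++ [σ])) := by
          gcongr
          exact hwin H hK
      _ = π.expectation ⟨G, H⟩ (fun σ => φ (H ++ [σ])) + q⁻¹ * π.eventProb ⟨G, H⟩ G.Win :=
          add_comm _ _
      _ ≤ q⁻¹ := π.expectation_add_mul_eventProb_le
          (fun σ hσ => if_pos ((Stage.isFinal_extend (S := ⟨G, H⟩)).2 (.inr hσ)))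
          fun σ hσ hp => (hφK (hnext H hK σ hσ hp)).le
  · exact le_top.trans_eq ((if_neg hH).trans (if_neg hK)).symm

/- With `v` the infimum of the expected coordination time on `K`: a round in `K` costs `1`, and
then at least `v` if the play stays in `K`, at least `1 ≥ v / 2` if it goes on outside `K`, and
`0` if it ends. As ending is no likelier than staying in `K`, this averages to `v ≥ 1 + v / 2`. -/
theorem two_le_ect_of_eventProb_win_le {K : Set (List G.Profile)}
    (hfinal : ∀ H ∈ K, ¬ (Stage.mk G H).IsFinal)
    (hwin : ∀ H ∈ K, π.eventProb ⟨G, H⟩ G.Win ≤ π.eventProb ⟨G, H⟩ {σ | H ++ [σ] ∈ K})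
    {H : List G.Profile} (hH : H ∈ K) : 2 ≤ π.ect ⟨G, H⟩ := by
  set v : ℝ≥0∞ := ⨅ H ∈ K, π.ect ⟨G, H⟩
  suffices 2 ≤ v from this.trans (iInf₂_le H hH)
  by_contra! hv
  have hvtop : v / 2 ≠ ⊤ := ENNReal.div_ne_top hv.ne_top two_ne_zero
  have hv1 : v / 2 ≤ 1 := ENNReal.div_le_of_le_mul (by simpa using hv.le)
  have hstep (H) (hK : H ∈ K) :
      v / 2 ≤ π.expectation ⟨G, H⟩ fun σ => π.ect ((Stage.mk G H).extend σ) := by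
    have hpt (σ : G.Profile) : v / 2 + v / 2 * Set.indicator {σ | H ++ [σ] ∈ K} 1 σ ≤
        π.ect ((Stage.mk G H).extend σ) + v / 2 * G.Win.indicator 1 σ := by
      by_cases hσK : H ++ [σ] ∈ K
      · have hle : v ≤ π.ect ((Stage.mk G H).extend σ) := iInf₂_le _ hσK
        simpa [hσK, ENNReal.add_halves] using hle.trans le_self_add
      by_cases hσ : σ ∈ G.Win
      · simp [hσK, hσ]
      · have hext : ¬ ((Stage.mk G H).extend σ).IsFinal := by
          simpa [Stage.isFinal_extend, hσ] using hfinal H hK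
        simpa [hσK, hσ] using hv1.trans (π.one_le_ect hext)
    have hsum := π.expectation_mono (S := ⟨G, H⟩) fun σ _ => hpt σ
    rw [expectation_add, expectation_add, expectation_const, expectation_mul_indicator,
      expectation_mul_indicator] at hsum
    have htop : v / 2 * π.eventProb ⟨G, H⟩ G.Win ≠ ⊤ :=
      ENNReal.mul_ne_top hvtop (ne_top_of_le_ne_top ENNReal.one_ne_top π.eventProb_le_one)
    refine (ENNReal.add_le_add_iff_right htop).1 (le_trans ?_ hsum)
    gcongr
    exact hwin H hK
  have hrec : 1 + v / 2 ≤ v / 2 + v / 2 := by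
    rw [ENNReal.add_halves]
    refine le_iInf₂ fun H hK => ?_
    rw [π.ect_of_not_isFinal (hfinal H hK)]
    exact add_le_add_right (hstep H hK) 1
  have hone : 1 ≤ v / 2 := (ENNReal.add_le_add_iff_right hvtop).1 hrec
  rw [ENNReal.le_div_iff_mul_le (by simp) (by simp), one_mul] at hone
  exact hv.not_ge hone

end FixedGame

end Protocol

namespace CM

variable {m : ℕ} [NeZero m]

/-- The profile of `CM m` in which the first player picks `x` and the second player picks `y`. -/
def profile (x y : Fin m) : (CM m).Profile := ![x, y]

theorem profile_eta (σ : (CM m).Profile) : profile (σ 0) (σ 1) = σ := by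
  funext i
  fin_cases i <;> rfl

theorem mem_win_iff {σ : (CM m).Profile} : σ ∈ (CM m).Win ↔ σ 0 = σ 1 :=
  ⟨fun h => h 0 1, fun h i j => by
    fin_cases i <;> fin_cases j <;> first | rfl | exact h | exact h.symm⟩

theorem profile_mem_win_iff {x y : Fin m} : profile x y ∈ (CM m).Win ↔ x = y :=
  mem_win_iff

theorem sum_profile {M : Type*} [AddCommMonoid M] (F : (CM m).Profile → M) :
    ∑ σ, F σ = ∑ x : Fin m, ∑ y : Fin m, F (profile x y) := by
  rw [← Fintype.sum_prod_type' (f := fun x y => F (profile x y))]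
  exact Fintype.sum_equiv (finTwoArrowEquiv (Fin m)) _ _ fun σ => congrArg F (profile_eta σ).symm

end CM

namespace Protocol

variable {m : ℕ} [NeZero m] (π : Protocol 2) {H : List (CM m).Profile}

/-- The mixed strategy of player `i` at the stage of `CM m` with history `H`, as a distribution
on `Fin m`. -/
noncomputable def cmStrategy (H : List (CM m).Profile) (i : Fin 2) : PMF (Fin m) := π ⟨CM m, H⟩ i

theorem profileProb_cm (x y : Fin m) :
    π.profileProb ⟨CM m, H⟩ (CM.profile x y) = π.cmStrategy H 0 x * π.cmStrategy H 1 y :=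
  Fin.prod_univ_two _

theorem profileProb_cm_ne_zero_iff {x y : Fin m} :
    π.profileProb ⟨CM m, H⟩ (CM.profile x y) ≠ 0 ↔
      x ∈ (π.cmStrategy H 0).support ∧ y ∈ (π.cmStrategy H 1).support := by
  rw [profileProb_cm, mul_ne_zero_iff, PMF.mem_support_iff, PMF.mem_support_iff]

theorem eventProb_graph (g : Fin m → Fin m) :
    π.eventProb ⟨CM m, H⟩ {σ | σ 1 = g (σ 0)} =
      ∑ x, π.cmStrategy H 0 x * π.cmStrategy H 1 (g x) := by
  have hind (x y : Fin m) : Set.indicator {σ : (CM m).Profile | σ 1 = g (σ 0)}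
      (1 : (CM m).Profile → ℝ≥0∞) (CM.profile x y) = if y = g x then 1 else 0 := by
    classical exact (Set.indicator_apply _ _ _).trans (if_congr Iff.rfl rfl rfl)
  refine (CM.sum_profile _).trans (Finset.sum_congr rfl fun x _ => ?_)
  simp only [hind, profileProb_cm, mul_ite, mul_one, mul_zero]
  exact Finset.sum_ite_eq' _ _ _ |>.trans (if_pos (Finset.mem_univ _))

theorem eventProb_win_cm :
    π.eventProb ⟨CM m, H⟩ (CM m).Win = ∑ x, π.cmStrategy H 0 x * π.cmStrategy H 1 x := by
  have hwin : (CM m).Win = {σ | σ 1 = σ 0} := Set.ext fun σ => CM.mem_win_iff.trans eq_comm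
  rw [hwin]
  exact π.eventProb_graph id

theorem eventProb_win_cm_of_uniform {B : Finset (Fin m)} (hB : B.Nonempty)
    (h : ∀ i, π.cmStrategy H i = PMF.uniformOfFinset B hB) :
    π.eventProb ⟨CM m, H⟩ (CM m).Win = (B.card : ℝ≥0∞)⁻¹ := by
  have hcard : (B.card : ℝ≥0∞) ≠ 0 := by simpa using hB.ne_empty
  simp [eventProb_win_cm, h, PMF.uniformOfFinset_apply, ← mul_assoc,
    ENNReal.mul_inv_cancel hcard]

end Protocol

theorem sum_mul_comp_perm_le_sum_mul_self {ι : Type*} [Fintype ι] {p : ι → ℝ≥0∞}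
    (hp : ∀ x, p x ≠ ⊤) (f : Equiv.Perm ι) : ∑ x, p x * p (f x) ≤ ∑ x, p x * p x := by
  lift p to ι → NNReal using hp
  beta_reduce
  exact_mod_cast (monovary_self p).sum_mul_comp_perm_le_sum_mul (σ := f)

/-- All rounds of `H` are of the form `(x, f x)`; if `f` is an involution, such rounds are
invariant under the exchange of the players combined with `f`. -/
def IsMirrored {m : ℕ} [NeZero m] (f : Equiv.Perm (Fin m)) (H : List (CM m).Profile) : Prop :=
  ∀ σ ∈ H, σ 1 = f (σ 0)

namespace IsMirrored

variable {m : ℕ} [NeZero m] {f : Equiv.Perm (Fin m)} {H : List (CM m).Profile}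

theorem not_isFinal (h : IsMirrored f H) (hfix : ∀ x, f x ≠ x) :
    ¬ (Stage.mk (CM m) H).IsFinal := by
  rintro ⟨σ, hσ, hwin⟩
  exact hfix (σ 0) ((h σ hσ).symm.trans (CM.mem_win_iff.1 hwin).symm)

theorem append_singleton_iff (h : IsMirrored f H) {σ : (CM m).Profile} :
    IsMirrored f (H ++ [σ]) ↔ σ 1 = f (σ 0) := by
  simp only [IsMirrored, List.forall_mem_append, List.forall_mem_singleton]
  exact and_iff_right h

/-- The exchange of the players combined with the involution `f`, as a renaming of a mirrored
stage to itself. -/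
def swapRenaming (h : IsMirrored f H) (hf : Function.Involutive f) :
    Renaming (Stage.mk (CM m) H) (Stage.mk (CM m) H) where
  perm := Equiv.swap 0 1
  toEquiv _ := f
  win_iff σ := by
    refine CM.mem_win_iff.trans (Iff.trans ?_ CM.mem_win_iff.symm)
    exact eq_comm.trans f.injective.eq_iff.symm
  history_eq := by
    refine (List.map_id H).symm.trans (List.map_congr_left fun σ hσ => ?_)
    funext i
    fin_cases i
    · exact ((congrArg f (h σ hσ)).trans (hf _)).symm
    · exact h σ hσ

theorem cmStrategy_one (h : IsMirrored f H) (hf : Function.Involutive f) {π : Protocol 2}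
    (hπ : π.IsStructural) (y : Fin m) : π.cmStrategy H 1 y = π.cmStrategy H 0 (f y) :=
  (hπ _ _ (h.swapRenaming hf) 0 y :)

theorem two_le_ect (h : IsMirrored f H) (hf : Function.Involutive f) (hfix : ∀ x, f x ≠ x)
    {π : Protocol 2} (hπ : π.IsStructural) : 2 ≤ π.ect ⟨CM m, H⟩ := by
  refine π.two_le_ect_of_eventProb_win_le (K := {H | IsMirrored f H})
    (fun H hH => hH.not_isFinal hfix) (fun H (hH : IsMirrored f H) => ?_) h
  let p := π.cmStrategy H 0
  calc π.eventProb ⟨CM m, H⟩ (CM m).Win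
      = ∑ x, p x * p (f x) := by
        simp only [π.eventProb_win_cm, hH.cmStrategy_one hf hπ, p]
    _ ≤ ∑ x, p x * p x := sum_mul_comp_perm_le_sum_mul_self p.apply_ne_top f
    _ = π.eventProb ⟨CM m, H⟩ {σ | IsMirrored f (H ++ [σ])} := by
        simp only [hH.append_singleton_iff, π.eventProb_graph, hH.cmStrategy_one hf hπ, hf _, p]

end IsMirrored

namespace Protocol

variable {m : ℕ} [NeZero m] {π : Protocol 2}

theorem cmStrategy_nil (hπ : π.IsStructural) (i : Fin 2) :
    π.cmStrategy [] i = PMF.uniformOfFintype (Fin m) := by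
  have hconst (c d : Fin m) : π.cmStrategy (m := m) [] i c = π.cmStrategy [] i d := by
    let r : Renaming (Stage.initial (CM m)) (Stage.initial (CM m)) :=
      { perm := 1
        toEquiv := fun _ => (Equiv.swap c d : Equiv.Perm (Fin m))
        win_iff := fun σ => by
          refine CM.mem_win_iff.trans (Iff.trans ?_ CM.mem_win_iff.symm)
          exact (Equiv.swap c d).injective.eq_iff.symm
        history_eq := rfl }
    exact (hπ _ _ r i c).trans
      (congrArg (π.cmStrategy [] i) (Equiv.swap_apply_left (α := Fin m) c d))
  ext c
  have hsum : π.cmStrategy [] i c * m = 1 := by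
    rw [← (π.cmStrategy (m := m) [] i).tsum_coe, tsum_fintype,
      Finset.sum_congr rfl fun d _ => hconst d c]
    simp [mul_comm]
  simpa using ENNReal.eq_inv_of_mul_eq_one_left hsum

theorem eventProb_win_initial_cm (hπ : π.IsStructural) :
    π.eventProb (Stage.initial (CM m)) (CM m).Win = (m : ℝ≥0∞)⁻¹ := by
  refine (π.eventProb_win_cm_of_uniform Finset.univ_nonempty (cmStrategy_nil hπ)).trans ?_
  simp

theorem one_add_le_ect_initial_cm (hπ : π.IsStructural) {c : ℝ≥0∞}
    (h : ∀ x y : Fin m, x ≠ y → c ≤ π.ect ⟨CM m, [CM.profile x y]⟩) :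
    1 + c ≤ π.ect (Stage.initial (CM m)) + c * (m : ℝ≥0∞)⁻¹ := by
  rw [π.ect_of_not_isFinal (Stage.not_isFinal_initial _), add_assoc,
    ← eventProb_win_initial_cm hπ]
  refine add_le_add_right (π.le_expectation_add_mul_eventProb fun σ hσ => ?_) 1
  rw [← CM.profile_eta σ] at hσ ⊢
  exact h _ _ (mt CM.profile_mem_win_iff.2 hσ)

theorem ect_initial_cm_add_le (hπ : π.IsStructural) {c : ℝ≥0∞}
    (h : ∀ x y : Fin m, x ≠ y → π.ect ⟨CM m, [CM.profile x y]⟩ ≤ c) :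
    π.ect (Stage.initial (CM m)) + c * (m : ℝ≥0∞)⁻¹ ≤ 1 + c := by
  rw [π.ect_of_not_isFinal (Stage.not_isFinal_initial _), add_assoc,
    ← eventProb_win_initial_cm hπ]
  refine add_le_add_right (π.expectation_add_mul_eventProb_le (fun σ hσ => ?_) fun σ hσ _ => ?_) 1
  · exact π.ect_of_isFinal (Stage.isFinal_extend.2 (.inr hσ))
  · rw [← CM.profile_eta σ] at hσ ⊢
    exact h _ _ (mt CM.profile_mem_win_iff.2 hσ)

theorem two_le_ect_cm_four_singleton (hπ : π.IsStructural) {x y : Fin 4} (hxy : x ≠ y) :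
    2 ≤ π.ect ⟨CM 4, [CM.profile x y]⟩ := by
  have hexists : ∀ x y : Fin 4, x ≠ y → ∃ f : Equiv.Perm (Fin 4),
      (∀ z, f (f z) = z) ∧ (∀ z, f z ≠ z) ∧ y = f x := by decide +kernel
  obtain ⟨f, hf, hfix, rfl⟩ := hexists x y hxy
  exact IsMirrored.two_le_ect (List.forall_mem_singleton.2 rfl) hf hfix hπ

theorem one_add_two_eq_add_two_mul_inv_four : (1 + 2 : ℝ≥0∞) = 2 + 1 / 2 + 2 * 4⁻¹ := by
  rw [← ENNReal.toReal_eq_toReal_iff' (by finiteness) (by finiteness)]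
  repeat rw [ENNReal.toReal_add (by finiteness) (by finiteness)]
  norm_num

theorem le_ect_initial_cm_four (hπ : π.IsStructural) :
    2 + 1 / 2 ≤ π.ect (Stage.initial (CM 4)) := by
  have h := one_add_le_ect_initial_cm hπ fun _ _ => two_le_ect_cm_four_singleton hπ
  rw [one_add_two_eq_add_two_mul_inv_four] at h
  exact (ENNReal.add_le_add_iff_right (by finiteness)).1 h

theorem ect_initial_cm_four (hπ : π.IsStructural)
    (h : ∀ x y, x ≠ y → π.ect ⟨CM 4, [CM.profile x y]⟩ ≤ 2) :
    π.ect (Stage.initial (CM 4)) = 2 + 1 / 2 := by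
  refine le_antisymm ?_ (le_ect_initial_cm_four hπ)
  have h := ect_initial_cm_add_le hπ h
  rw [one_add_two_eq_add_two_mul_inv_four] at h
  exact (ENNReal.add_le_add_iff_right (by finiteness)).1 h

theorem isECTOptimal_cm_four (hπ : π.IsStructural)
    (h : ∀ x y, x ≠ y → π.ect ⟨CM 4, [CM.profile x y]⟩ ≤ 2) : π.IsECTOptimal (CM 4) :=
  ⟨hπ, fun _ hπ' => (ect_initial_cm_four hπ h).trans_le (le_ect_initial_cm_four hπ')⟩

theorem ect_cm_le_two {K : Set (List (CM m).Profile)}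
    (hfinal : ∀ H ∈ K, ¬ (Stage.mk (CM m) H).IsFinal)
    (hpair : ∀ H ∈ K, ∃ (B : Finset (Fin m)) (hB : B.Nonempty), B.card = 2 ∧
      (∀ i, π.cmStrategy H i = PMF.uniformOfFinset B hB) ∧
      ∀ x ∈ B, ∀ y ∈ B, x ≠ y → H ++ [CM.profile x y] ∈ K)
    {H : List (CM m).Profile} (hH : H ∈ K) : π.ect ⟨CM m, H⟩ ≤ 2 := by
  rw [← inv_inv (2 : ℝ≥0∞)]
  refine π.ect_le_inv_of_le_eventProb_win hfinal (fun H hH => ?_) (fun H hH σ hσ hp => ?_) hH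
  · obtain ⟨B, hB, hcard, huniform, -⟩ := hpair H hH
    rw [π.eventProb_win_cm_of_uniform hB huniform, hcard, Nat.cast_ofNat]
  · obtain ⟨B, hB, -, huniform, hnext⟩ := hpair H hH
    obtain ⟨x, y, rfl⟩ : ∃ x y, σ = CM.profile x y := ⟨_, _, (CM.profile_eta σ).symm⟩
    rw [profileProb_cm_ne_zero_iff, huniform, huniform, PMF.support_uniformOfFinset] at hp
    exact hnext x hp.1 y hp.2 (mt CM.profile_mem_win_iff.2 hσ)

end Protocol

section Uniform

variable {α β : Type*}

theorem map_uniformOfFinset {s : Finset α} {t : Finset β} (hs : s.Nonempty) (ht : t.Nonempty)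
    (e : α ≃ β) (h : t = s.map e.toEmbedding) :
    (PMF.uniformOfFinset s hs).map e = PMF.uniformOfFinset t ht := by
  classical
  subst h
  ext b
  obtain ⟨a, rfl⟩ := e.surjective b
  simp [PMF.map_apply, PMF.uniformOfFinset_apply, e.injective.eq_iff]

theorem map_uniformOfFintype [Fintype α] [Nonempty α] [Fintype β] [Nonempty β] (e : α ≃ β) :
    (PMF.uniformOfFintype α).map e = PMF.uniformOfFintype β :=
  map_uniformOfFinset _ _ e (Finset.map_univ_equiv e).symm

theorem bind_bool_pure_uniformOfFinset [DecidableEq α] {u v : α} (huv : u ≠ v) {s t : Finset α}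
    (hs : s.Nonempty) (ht : t.Nonempty) (hsv : s = {v}) (htuv : t = {u, v}) :
    ((PMF.uniformOfFintype Bool).bind fun b =>
      if b then PMF.pure u else PMF.uniformOfFinset s hs) = PMF.uniformOfFinset t ht := by
  subst hsv htuv
  ext a
  rw [PMF.bind_apply, tsum_bool]
  by_cases hu : a = u <;> by_cases hv : a = v <;>
    simp_all [PMF.uniformOfFinset_apply, PMF.pure_apply]

/-- The uniform distribution on `s`, or on the whole type in case `s` is empty. -/
noncomputable def uniformOrAll [Fintype α] [Nonempty α] (s : Finset α) : PMF α :=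
  open Classical in
  if h : s.Nonempty then PMF.uniformOfFinset s h else PMF.uniformOfFintype α

theorem uniformOrAll_of_nonempty [Fintype α] [Nonempty α] {s : Finset α} (h : s.Nonempty) :
    uniformOrAll s = PMF.uniformOfFinset s h :=
  dif_pos h

theorem map_uniformOrAll [Fintype α] [Nonempty α] [Fintype β] [Nonempty β] (s : Finset α)
    (e : α ≃ β) : (uniformOrAll s).map e = uniformOrAll (s.map e.toEmbedding) := by
  simp only [uniformOrAll, Finset.map_nonempty]
  split_ifs with h
  · exact map_uniformOfFinset _ _ e rfl
  · exact map_uniformOfFintype e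

end Uniform

namespace Renaming

section Players

variable {n : ℕ} {S S' : Stage n}

/-- The action of a renaming on profiles. -/
def mapProfile (r : Renaming S S') (σ : S.game.Profile) : S'.game.Profile :=
  fun i => r.toEquiv i (σ (r.perm i))

theorem mapProfile_surjective (r : Renaming S S') : Function.Surjective r.mapProfile := by
  intro τ
  refine ⟨Equiv.piCongrLeft S.game.Choice r.perm fun i => (r.toEquiv i).symm (τ i),
    funext fun i => ?_⟩
  simp [mapProfile, Equiv.piCongrLeft_apply_apply]

theorem mapProfile_mem_win_iff (r : Renaming S S') {σ : S.game.Profile} :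
    r.mapProfile σ ∈ S'.game.Win ↔ σ ∈ S.game.Win :=
  (r.win_iff σ).symm

theorem history_eq_map (r : Renaming S S') : S'.history = S.history.map r.mapProfile :=
  r.history_eq

theorem isFinal_iff (r : Renaming S S') : S'.IsFinal ↔ S.IsFinal := by
  simp [Stage.IsFinal, r.history_eq_map, r.mapProfile_mem_win_iff]

theorem played_eq (r : Renaming S S') (i : Fin n) :
    S'.played i = (S.played (r.perm i)).map (r.toEquiv i).toEmbedding := by
  ext c
  simp [Stage.mem_played, r.history_eq_map, mapProfile, Equiv.eq_symm_apply]

theorem forall_card_played_iff (r : Renaming S S') (k : ℕ) :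
    (∀ i, (S'.played i).card = k) ↔ ∀ i, (S.played i).card = k := by
  simp only [r.played_eq, Finset.card_map]
  exact r.perm.forall_congr_right (q := fun i => (S.played i).card = k)

end Players

theorem coordinating_eq {S S' : Stage 2} (r : Renaming S S') (σ : S.game.Profile) (i : Fin 2) :
    coordinating S'.game i (r.mapProfile σ i.rev) =
      (coordinating S.game (r.perm i) (σ (r.perm i).rev)).map (r.toEquiv i).toEmbedding := by
  have apply_rev : ∀ (e : Equiv.Perm (Fin 2)) (i : Fin 2), (e i).rev = e i.rev := by decide
  ext c
  simp only [coordinating, Finset.mem_map_equiv, Finset.mem_filter_univ,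
    r.mapProfile_surjective.exists]
  refine exists_congr fun τ => ?_
  rw [r.mapProfile_mem_win_iff, apply_rev, Equiv.eq_symm_apply]
  simp [mapProfile]

end Renaming

theorem Protocol.isStructural_of_map_eq {n : ℕ} {π : Protocol n}
    (h : ∀ (S S' : Stage n) (r : Renaming S S') (i : Fin n),
      (π S (r.perm i)).map (r.toEquiv i) = π S' i) : π.IsStructural := by
  classical
  intro S S' r i c
  rw [← h S S' r i, PMF.map_apply]
  simp [(r.toEquiv i).injective.eq_iff]

theorem Stage.played_nonempty {n : ℕ} {S : Stage n} {σ : S.game.Profile}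
    {H : List S.game.Profile} (h : S.history = σ :: H) (i : Fin n) : (S.played i).Nonempty :=
  ⟨σ i, mem_played.2 ⟨σ, by simp [h], rfl⟩⟩

section WaitOrMove

theorem waitOrMove_of_history_eq_nil {S : Stage 2} (h : S.history = []) (i : Fin 2) :
    waitOrMove S i = PMF.uniformOfFintype _ := by
  obtain ⟨G, _ | _⟩ := S
  · rfl
  · exact absurd h (List.cons_ne_nil _ _)

open Classical in
theorem waitOrMove_of_history_eq_cons {S : Stage 2} {σ : S.game.Profile}
    {H : List S.game.Profile} (h : S.history = σ :: H) (i : Fin 2) :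
    waitOrMove S i =
      if S.IsFinal then PMF.uniformOfFintype _
      else if ∀ j, (S.played j).card = 1 then
        (PMF.uniformOfFintype Bool).bind fun b =>
          if b then PMF.pure (σ i)
          else PMF.uniformOfFinset (coordinating S.game i (σ i.rev)) (coordinating_nonempty _ i _)
      else if ∀ j, (S.played j).card = 2 then
        PMF.uniformOfFinset (S.played i) (Stage.played_nonempty h i)
      else PMF.uniformOfFintype _ := by
  obtain ⟨G, _ | _⟩ := S
  · exact absurd h.symm (List.cons_ne_nil _ _)
  · obtain ⟨rfl, rfl⟩ := List.cons.inj h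
    rfl

theorem waitOrMove_isStructural : waitOrMove.IsStructural := by
  classical
  refine Protocol.isStructural_of_map_eq fun S S' r i => ?_
  rcases hH : S.history with _ | ⟨σ, H⟩
  · rw [waitOrMove_of_history_eq_nil hH,
      waitOrMove_of_history_eq_nil (by rw [r.history_eq_map, hH, List.map_nil])]
    exact map_uniformOfFintype _
  have hH' : S'.history = r.mapProfile σ :: H.map r.mapProfile := by
    rw [r.history_eq_map, hH, List.map_cons]
  rw [waitOrMove_of_history_eq_cons hH, waitOrMove_of_history_eq_cons hH']
  rw [apply_ite (PMF.map (r.toEquiv i)), apply_ite (PMF.map (r.toEquiv i)),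
    apply_ite (PMF.map (r.toEquiv i))]
  refine if_congr r.isFinal_iff.symm (map_uniformOfFintype _) <|
    if_congr (r.forall_card_played_iff 1).symm ?_ <|
    if_congr (r.forall_card_played_iff 2).symm
      (map_uniformOfFinset _ _ _ (r.played_eq i)) (map_uniformOfFintype _)
  rw [PMF.map_bind]
  congr 1
  funext b
  cases b
  · exact map_uniformOfFinset (coordinating_nonempty _ _ _) (coordinating_nonempty _ _ _) _
      (r.coordinating_eq σ i)
  · exact PMF.pure_map _ _

variable {m : ℕ} [NeZero m] {x y : Fin m} {T : List (CM m).Profile}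

theorem coordinating_cm (i : Fin 2) (c : Fin m) :
    coordinating (CM m) i c = ({c} : Finset (Fin m)) := by
  classical
  refine Finset.ext fun (d : Fin m) =>
    Finset.mem_filter.trans <| (and_iff_right (Finset.mem_univ _)).trans <|
      Iff.trans ⟨?_, fun h => ?_⟩ Finset.mem_singleton.symm
  · rintro ⟨σ, hσ, rfl, rfl⟩
    exact hσ i i.rev
  · exact ⟨fun _ => d, fun _ _ => rfl, rfl, h⟩

theorem played_cm_eq_singleton (hT : ∀ τ ∈ T, τ = CM.profile x y) (i : Fin 2) :
    (Stage.mk (CM m) (CM.profile x y :: T)).played i = ({CM.profile x y i} : Finset (Fin m)) := by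
  refine Finset.ext fun (c : Fin m) =>
    Stage.mem_played.trans (Iff.trans ⟨?_, fun h => ?_⟩ (Finset.mem_singleton (α := Fin m)).symm)
  · rintro ⟨σ, hσ, rfl⟩
    rw [(List.mem_cons.1 hσ).elim id (hT σ)]
  · exact ⟨_, List.mem_cons_self, h.symm⟩

theorem played_cm_eq_pair (hT : ∀ τ ∈ T, τ = CM.profile x y ∨ τ = CM.profile y x)
    (hmem : CM.profile y x ∈ T) (i : Fin 2) :
    (Stage.mk (CM m) (CM.profile x y :: T)).played i = ({x, y} : Finset (Fin m)) := by
  refine Finset.ext fun (c : Fin m) =>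
    Stage.mem_played.trans (Iff.trans ⟨?_, ?_⟩ (Finset.mem_insert (α := Fin m)).symm)
  · rintro ⟨σ, hσ, rfl⟩
    rcases List.forall_mem_cons.2 ⟨.inl rfl, hT⟩ σ hσ with rfl | rfl <;> fin_cases i <;>
      simp [CM.profile]
  · rw [Finset.mem_singleton]
    have hxy : CM.profile x y ∈ CM.profile x y :: T := List.mem_cons_self
    have hyx : CM.profile y x ∈ CM.profile x y :: T := List.mem_cons_of_mem _ hmem
    rintro (rfl | rfl) <;> fin_cases i
    exacts [⟨_, hxy, rfl⟩, ⟨_, hyx, rfl⟩, ⟨_, hyx, rfl⟩, ⟨_, hxy, rfl⟩]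

theorem not_isFinal_cm_pair (hxy : x ≠ y) (hT : ∀ τ ∈ T, τ = CM.profile x y ∨ τ = CM.profile y x) :
    ¬ (Stage.mk (CM m) (CM.profile x y :: T)).IsFinal := by
  rintro ⟨σ, hσ, hwin⟩
  rcases List.mem_cons.1 hσ with rfl | hσ
  · exact hxy (CM.profile_mem_win_iff.1 hwin)
  · rcases hT σ hσ with rfl | rfl
    · exact hxy (CM.profile_mem_win_iff.1 hwin)
    · exact hxy (CM.profile_mem_win_iff.1 hwin).symm

theorem waitOrMove_cmStrategy (hxy : x ≠ y)
    (hT : ∀ τ ∈ T, τ = CM.profile x y ∨ τ = CM.profile y x) (i : Fin 2) :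
    waitOrMove.cmStrategy (CM.profile x y :: T) i =
      PMF.uniformOfFinset {x, y} (Finset.insert_nonempty x {y}) := by
  refine (waitOrMove_of_history_eq_cons rfl i).trans ?_
  rw [if_neg (not_isFinal_cm_pair hxy hT)]
  by_cases hmem : CM.profile y x ∈ T
  · have hcard (j : Fin 2) : ((Stage.mk (CM m) (CM.profile x y :: T)).played j).card = 2 :=
      (congrArg Finset.card (played_cm_eq_pair hT hmem j)).trans
        (Finset.card_pair (α := Fin m) hxy)
    rw [if_neg fun h => by simpa [hcard] using h 0, if_pos hcard]
    congr 1
    exact played_cm_eq_pair hT hmem i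
  · have hT' (τ) (hτ : τ ∈ T) : τ = CM.profile x y :=
      (hT τ hτ).resolve_right fun h => hmem (h ▸ hτ)
    rw [if_pos fun j => (congrArg Finset.card (played_cm_eq_singleton hT' j)).trans
      (Finset.card_singleton (α := Fin m) _)]
    fin_cases i
    · exact bind_bool_pure_uniformOfFinset (α := Fin m) hxy _ _ (coordinating_cm 0 y) rfl
    · exact bind_bool_pure_uniformOfFinset (α := Fin m) hxy.symm _ _ (coordinating_cm 1 x)
        (Finset.pair_comm x y)

theorem waitOrMove_ect_cm_le_two (hxy : x ≠ y) : waitOrMove.ect ⟨CM m, [CM.profile x y]⟩ ≤ 2 := by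
  let K := {H | ∃ T, H = CM.profile x y :: T ∧ ∀ τ ∈ T, τ = CM.profile x y ∨ τ = CM.profile y x}
  refine waitOrMove.ect_cm_le_two (K := K) ?_ ?_ ⟨[], rfl, List.forall_mem_nil _⟩
  · rintro _ ⟨T, rfl, hT⟩
    exact not_isFinal_cm_pair hxy hT
  · rintro _ ⟨T, rfl, hT⟩
    refine ⟨{x, y}, Finset.insert_nonempty x {y}, Finset.card_pair hxy,
      waitOrMove_cmStrategy hxy hT, fun u hu v hv huv => ⟨T ++ [CM.profile u v], rfl, ?_⟩⟩
    simp only [Finset.mem_insert, Finset.mem_singleton] at hu hv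
    rw [List.forall_mem_append, List.forall_mem_singleton]
    refine ⟨hT, ?_⟩
    grind

end WaitOrMove

theorem Protocol.eq_of_reachableRestrict_eq {n : ℕ} {π π' : Protocol n} {G : WLCGame n}
    (h : π.reachableRestrict G = π'.reachableRestrict G) {H : List G.Profile}
    (hH : π.Reachable G H) : π ⟨G, H⟩ = π' ⟨G, H⟩ := by
  have hrestrict := congrFun h H
  simp only [reachableRestrict, if_pos hH] at hrestrict
  split_ifs at hrestrict
  exact Option.some.inj hrestrict

section BlockProtocol

open Classical in
/-- The choice of player `i` in `σ` together with the choices that coordinate with the choice of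
the other player in `σ` or, for `b = false`, the complement of this set. -/
noncomputable def profileBlock (G : WLCGame 2) (σ : G.Profile) (i : Fin 2) (b : Bool) :
    Finset (G.Choice i) :=
  {c | c = σ i ∨ c ∈ coordinating G i (σ i.rev) ↔ b}

theorem mem_profileBlock {G : WLCGame 2} {σ : G.Profile} {i : Fin 2} {b : Bool} {c : G.Choice i} :
    c ∈ profileBlock G σ i b ↔ (c = σ i ∨ c ∈ coordinating G i (σ i.rev) ↔ b) := by
  simp [profileBlock]

theorem Renaming.profileBlock_eq {S S' : Stage 2} (r : Renaming S S') (σ : S.game.Profile)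
    (i : Fin 2) (b : Bool) :
    profileBlock S'.game (r.mapProfile σ) i b =
      (profileBlock S.game σ (r.perm i) b).map (r.toEquiv i).toEmbedding := by
  ext c
  have hcoord := Finset.ext_iff.1 (r.coordinating_eq σ i) c
  have hown : c = r.mapProfile σ i ↔ (r.toEquiv i).symm c = σ (r.perm i) :=
    (Equiv.symm_apply_eq _).symm
  rw [Finset.mem_map_equiv] at hcoord ⊢
  simp [mem_profileBlock, hcoord, hown]

/-- The protocol that starts uniformly and then, with `n + 1` rounds played, chooses uniformly
from the block of the first profile selected by the bit `s n`. Different bit sequences lead to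
different optimal protocols for `CM 4`. -/
noncomputable def blockProtocol (s : ℕ → Bool) : Protocol 2
  | ⟨_, []⟩, _ => PMF.uniformOfFintype _
  | ⟨G, σ :: H⟩, i => uniformOrAll (profileBlock G σ i (s H.length))

variable (s : ℕ → Bool)

theorem blockProtocol_of_history_eq_nil {S : Stage 2} (h : S.history = []) (i : Fin 2) :
    blockProtocol s S i = PMF.uniformOfFintype _ := by
  obtain ⟨G, _ | _⟩ := S
  · rfl
  · exact absurd h (List.cons_ne_nil _ _)

theorem blockProtocol_of_history_eq_cons {S : Stage 2} {σ : S.game.Profile}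
    {H : List S.game.Profile} (h : S.history = σ :: H) (i : Fin 2) :
    blockProtocol s S i = uniformOrAll (profileBlock S.game σ i (s H.length)) := by
  obtain ⟨G, _ | _⟩ := S
  · exact absurd h.symm (List.cons_ne_nil _ _)
  · obtain ⟨rfl, rfl⟩ := List.cons.inj h
    rfl

theorem blockProtocol_isStructural : (blockProtocol s).IsStructural := by
  refine Protocol.isStructural_of_map_eq fun S S' r i => ?_
  rcases hH : S.history with _ | ⟨σ, H⟩
  · rw [blockProtocol_of_history_eq_nil s hH,
      blockProtocol_of_history_eq_nil s (by rw [r.history_eq_map, hH, List.map_nil])]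
    exact map_uniformOfFintype _
  · have hH' : S'.history = r.mapProfile σ :: H.map r.mapProfile := by
      rw [r.history_eq_map, hH, List.map_cons]
    rw [blockProtocol_of_history_eq_cons s hH, blockProtocol_of_history_eq_cons s hH',
      List.length_map, r.profileBlock_eq, map_uniformOrAll]

/-- The block of the profile `(x, y)` in `CM m`, which is the same for both players. -/
def pairBlock {m : ℕ} (x y : Fin m) (b : Bool) : Finset (Fin m) :=
  {c | c = x ∨ c = y ↔ b}

theorem mem_pairBlock {m : ℕ} {x y c : Fin m} {b : Bool} :
    c ∈ pairBlock x y b ↔ (c = x ∨ c = y ↔ b) := by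
  simp [pairBlock]

theorem profileBlock_cm {m : ℕ} [NeZero m] (x y : Fin m) (i : Fin 2) (b : Bool) :
    profileBlock (CM m) (CM.profile x y) i b = pairBlock x y b := by
  refine Finset.ext fun (c : Fin m) =>
    mem_profileBlock.trans ((iff_congr ?_ Iff.rfl).trans mem_pairBlock.symm)
  have hcoord : c ∈ (coordinating (CM m) i (CM.profile x y i.rev) : Finset (Fin m)) ↔
      c = CM.profile x y i.rev :=
    (Finset.ext_iff.1 (coordinating_cm i _) c).trans Finset.mem_singleton
  refine (or_congr_right hcoord).trans ?_
  fin_cases i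
  · rfl
  · exact or_comm

theorem card_pairBlock {x y : Fin 4} (hxy : x ≠ y) (b : Bool) : (pairBlock x y b).card = 2 := by
  revert x y b
  decide

theorem pairBlock_nonempty {x y : Fin 4} (hxy : x ≠ y) (b : Bool) : (pairBlock x y b).Nonempty :=
  Finset.card_pos.1 (card_pairBlock hxy b ▸ two_pos)

theorem blockProtocol_cmStrategy {x y : Fin 4} (hxy : x ≠ y) (T : List (CM 4).Profile)
    (i : Fin 2) :
    (blockProtocol s).cmStrategy (CM.profile x y :: T) i =
      PMF.uniformOfFinset (pairBlock x y (s T.length)) (pairBlock_nonempty hxy _) := by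
  refine (blockProtocol_of_history_eq_cons s rfl i).trans ?_
  refine (congrArg uniformOrAll (profileBlock_cm x y i _)).trans ?_
  exact uniformOrAll_of_nonempty (α := Fin 4) _

theorem blockProtocol_ect_cm_four_le_two {x y : Fin 4} (hxy : x ≠ y) :
    (blockProtocol s).ect ⟨CM 4, [CM.profile x y]⟩ ≤ 2 := by
  let K := {H | ¬ (Stage.mk (CM 4) H).IsFinal ∧ ∃ T, H = CM.profile x y :: T}
  have hsingleton : ¬ (Stage.mk (CM 4) [CM.profile x y]).IsFinal := fun ⟨σ, hσ, hwin⟩ =>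
    hxy (CM.profile_mem_win_iff.1 (List.mem_singleton.1 hσ ▸ hwin))
  refine (blockProtocol s).ect_cm_le_two (K := K) (fun H hH => hH.1) ?_ ⟨hsingleton, [], rfl⟩
  rintro _ ⟨hfinal, T, rfl⟩
  refine ⟨_, _, card_pairBlock hxy _, blockProtocol_cmStrategy s hxy T,
    fun u _ v _ huv => ⟨?_, T ++ [CM.profile u v], rfl⟩⟩
  exact fun h => (Stage.isFinal_extend.1 h).elim hfinal (mt CM.profile_mem_win_iff.1 huv)

theorem blockProtocol_isECTOptimal : (blockProtocol s).IsECTOptimal (CM 4) :=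
  Protocol.isECTOptimal_cm_four (blockProtocol_isStructural s)
    fun _ _ => blockProtocol_ect_cm_four_le_two s

theorem reachable_cm_singleton {m : ℕ} [NeZero m] {π : Protocol 2} (hπ : π.IsStructural)
    {x y : Fin m} (hxy : x ≠ y) : π.Reachable (CM m) [CM.profile x y] := by
  refine .step [] _ .initial (mt CM.profile_mem_win_iff.1 hxy) ?_
  simp [Protocol.profileProb_cm_ne_zero_iff, Protocol.cmStrategy_nil hπ]

theorem exists_reachable_blockProtocol {x y : Fin 4} (hxy : x ≠ y) (n : ℕ) :
    ∃ T, T.length = n ∧ (blockProtocol s).Reachable (CM 4) (CM.profile x y :: T) := by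
  induction n with
  | zero => exact ⟨[], rfl, reachable_cm_singleton (blockProtocol_isStructural s) hxy⟩
  | succ n ih =>
    obtain ⟨T, rfl, hT⟩ := ih
    obtain ⟨u, hu, v, hv, huv⟩ : ∃ u ∈ pairBlock x y (s T.length),
        ∃ v ∈ pairBlock x y (s T.length), u ≠ v :=
      Finset.one_lt_card.1 (one_lt_two.trans_eq (card_pairBlock hxy _).symm)
    refine ⟨T ++ [CM.profile u v], List.length_append,
      .step _ _ hT (mt CM.profile_mem_win_iff.1 huv) ?_⟩
    simpa [Protocol.profileProb_cm_ne_zero_iff, blockProtocol_cmStrategy s hxy] using ⟨hu, hv⟩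

theorem bit_eq_of_blockProtocol_eq {x y : Fin 4} (hxy : x ≠ y) {s s' : ℕ → Bool}
    {T : List (CM 4).Profile}
    (h : blockProtocol s ⟨CM 4, CM.profile x y :: T⟩ =
      blockProtocol s' ⟨CM 4, CM.profile x y :: T⟩) : s T.length = s' T.length := by
  have hmem (b : Bool) : x ∈ pairBlock x y b ↔ b := by simp [mem_pairBlock]
  have hsupport : pairBlock x y (s T.length) = pairBlock x y (s' T.length) := by
    have h0 : (blockProtocol s).cmStrategy (CM.profile x y :: T) 0 =
        (blockProtocol s').cmStrategy (CM.profile x y :: T) 0 := congrFun h 0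
    rw [blockProtocol_cmStrategy s hxy, blockProtocol_cmStrategy s' hxy] at h0
    simpa using congrArg PMF.support h0
  rw [Bool.eq_iff_iff, ← hmem, hsupport, hmem]

theorem eq_of_forall_reachable_blockProtocol {s s' : ℕ → Bool}
    (h : ∀ H, (blockProtocol s).Reachable (CM 4) H →
      blockProtocol s ⟨CM 4, H⟩ = blockProtocol s' ⟨CM 4, H⟩) : s = s' := by
  have h01 : (0 : Fin 4) ≠ 1 := by decide
  funext n
  obtain ⟨T, rfl, hT⟩ := exists_reachable_blockProtocol s h01 n
  exact bit_eq_of_blockProtocol_eq h01 (h _ hT)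

theorem blockProtocol_restrict_injective :
    Function.Injective fun s => (blockProtocol s).restrict (CM 4) :=
  fun _ _ h => eq_of_forall_reachable_blockProtocol fun H _ => congrFun h H

theorem blockProtocol_reachableRestrict_injective :
    Function.Injective fun s => (blockProtocol s).reachableRestrict (CM 4) :=
  fun _ _ h => eq_of_forall_reachable_blockProtocol fun _ => Protocol.eq_of_reachableRestrict_eq h

theorem not_isUniquelyECTOptimal_cm_four (π : Protocol 2) : ¬ π.IsUniquelyECTOptimal (CM 4) := by
  rintro ⟨⟨hπ, -⟩, hunique⟩
  have h01 : (0 : Fin 4) ≠ 1 := by decide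
  have heq (s : ℕ → Bool) :=
    hunique _ (blockProtocol_isECTOptimal s) _ (reachable_cm_singleton hπ h01)
  have hbit := bit_eq_of_blockProtocol_eq h01 ((heq fun _ => true).trans (heq fun _ => false).symm)
  exact Bool.noConfusion hbit

end BlockProtocol

section Cardinality

universe u v

theorem mk_pi_le_continuum {ι : Type u} [Countable ι] {α : ι → Type v} (h : ∀ i, #(α i) ≤ 𝔠) :
    #(∀ i, α i) ≤ 𝔠 := by
  rw [Cardinal.mk_pi]
  refine (Cardinal.prod_le_prod _ _ h).trans ?_
  rw [Cardinal.prod_const, Cardinal.lift_continuum]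
  exact (Cardinal.power_le_power_left Cardinal.continuum_ne_zero
    (Cardinal.lift_le_aleph0.2 (Cardinal.mk_le_aleph0 (α := ι)))).trans_eq
      Cardinal.continuum_power_aleph0

theorem mk_pmf_le_continuum (α : Type u) [Countable α] : #(PMF α) ≤ 𝔠 := by
  have hinj : Function.Injective fun (p : PMF α) (a : α) => (p a).toReal := fun p q h =>
    PMF.ext fun a => (ENNReal.toReal_eq_toReal_iff' (p.apply_ne_top a) (q.apply_ne_top a)).1
      (congrFun h a)
  exact (Cardinal.mk_le_of_injective hinj).trans
    (mk_pi_le_continuum (α := fun _ => ℝ) fun _ => Cardinal.mk_real.le)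

theorem mk_option_le_continuum {α : Type u} (h : #α ≤ 𝔠) : #(Option α) ≤ 𝔠 := by
  rw [Cardinal.mk_option]
  exact Cardinal.add_le_of_le Cardinal.aleph0_le_continuum h
    (Cardinal.one_le_aleph0.trans Cardinal.aleph0_le_continuum)

theorem mk_pmf_choice_le_continuum {n : ℕ} (G : WLCGame n) : #(∀ i, PMF (G.Choice i)) ≤ 𝔠 :=
  mk_pi_le_continuum fun i => mk_pmf_le_continuum (G.Choice i)

theorem mk_ne_and_eq_continuum {α : Type u} (hα : #α ≤ 𝔠) (a : α) {P : α → Prop}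
    {g : (ℕ → Bool) → α} (hg : Function.Injective g) (hP : ∀ s, P (g s)) :
    #{x | x ≠ a ∧ P x} = 𝔠 := by
  refine le_antisymm ((Cardinal.mk_set_le _).trans hα) ?_
  by_contra! hlt
  have hrange : Set.range g ⊆ insert a {x | x ≠ a ∧ P x} := by
    rintro _ ⟨s, rfl⟩
    exact (eq_or_ne (g s) a).imp_right fun hne => ⟨hne, hP s⟩
  refine lt_irrefl 𝔠 ?_
  calc 𝔠
      = #(Set.range g) := by simpa using (Cardinal.mk_range_eq_of_injective hg).symm
    _ ≤ #{x | x ≠ a ∧ P x} + 1 := (Cardinal.mk_le_mk_of_subset hrange).trans Cardinal.mk_insert_le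
    _ < 𝔠 := Cardinal.add_lt_of_lt Cardinal.aleph0_le_continuum hlt
      (Cardinal.one_lt_aleph0.trans Cardinal.aleph0_lt_continuum)

end Cardinality

theorem mainTheorem9 :
    waitOrMove.IsECTOptimal (CM 4) ∧
    waitOrMove.ect (Stage.initial (CM 4)) = 2 + 1 / 2 ∧
    -- continuum many other optimal protocols, counted by their behaviour in the game
    #{f : List (CM 4).Profile → ∀ i, PMF ((CM 4).Choice i) |
        f ≠ waitOrMove.restrict (CM 4) ∧
        ∃ π : Protocol 2, π.IsECTOptimal (CM 4) ∧ π.restrict (CM 4) = f} = 𝔠 ∧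
    -- the same when only the behaviour at the reachable stages is counted
    #{f : List (CM 4).Profile → Option (∀ i, PMF ((CM 4).Choice i)) |
        f ≠ waitOrMove.reachableRestrict (CM 4) ∧
        ∃ π : Protocol 2, π.IsECTOptimal (CM 4) ∧ π.reachableRestrict (CM 4) = f} = 𝔠 ∧
    -- no protocol is uniquely optimal
    ∀ π : Protocol 2, ¬ π.IsUniquelyECTOptimal (CM 4) := by
  have hwait (x y : Fin 4) := waitOrMove_ect_cm_le_two (x := x) (y := y)
  have hmk := mk_pi_le_continuum fun _ : List (CM 4).Profile => mk_pmf_choice_le_continuum (CM 4)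
  have hmk_option := mk_pi_le_continuum fun _ : List (CM 4).Profile =>
    mk_option_le_continuum (mk_pmf_choice_le_continuum (CM 4))
  exact ⟨Protocol.isECTOptimal_cm_four waitOrMove_isStructural hwait,
    Protocol.ect_initial_cm_four waitOrMove_isStructural hwait,
    mk_ne_and_eq_continuum hmk _ blockProtocol_restrict_injective
      fun s => ⟨_, blockProtocol_isECTOptimal s, rfl⟩,
    mk_ne_and_eq_continuum hmk_option _ blockProtocol_reachableRestrict_injective
      fun s => ⟨_, blockProtocol_isECTOptimal s, rfl⟩,
    not_isUniquelyECTOptimal_cm_four⟩
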